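/- Let $n\ge 1$ and let $\Omega\subset\mathbb R^n$ be a nonempty bounded convex open set. Put $\Lambda_\infty(\Omega)=2/\operatorname{diam}(\Omega)$ and $\Delta_\infty u=\sum_{i,j}u_{x_i}u_{x_ix_j}u_{x_j}$. A Neumann $\infty$-eigenfunction associated with $\Lambda$ is a function $u\in C(\overline\Omega)$, not identically zero in $\Omega$, that is a viscosity solution of $$\begin{cases}\min\{|\nabla u|-\Lambda u,\,-\Delta_\infty u\}=0 & \text{in }\{u>0\}\cap\Omega,\\ \max\{-|\nabla u|-\Lambda u,\,-\Delta_\infty u\}=0 & \text{in }\{u<0\}\cap\Omega,\\ -\Delta_\infty u=0 & \text{in }\{u=0\}\cap\Omega,\\ \partial u/\partial\nu=0 & \text{on }\partial\Omega,\end{cases}$$ where the boundary condition is also understood in the viscosity sense: writing $F$ for the operator that belongs to the sign of $u(x)$, every $C^2$ function $\varphi$ touching $u$ from above (relative to $\overline\Omega$) at $x\in\partial\Omega$ satisfies $\min\{F\varphi,\partial\varphi/\partial\nu\}(x)\le 0$ for some unit outer normal $\nu$ at $x$, and every $C^2$ function $\psi$ touching $u$ from below satisfies $\max\{F\psi,\partial\psi/\partial\nu\}(x)\ge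 0$ for some unit outer normal $\nu$ at $x$ (a unit outer normal at $x$ is a unit vector $\nu$ with $\nu\cdot(y-x)\le0$ for all $y\in\Omega$; it is unique where $\partial\Omega$ is smooth). Then no Neumann $\infty$-eigenfunction $u$ associated with $\Lambda_\infty(\Omega)$ has a closed nodal line inside $\Omega$. That is, there is no compact set $\Gamma\subset\{x\in\Omega: u(x)=0\}$ (for instance a closed curve if $n=2$, or a closed hypersurface) such that some point $x\in\Omega$ with $u(x)\neq0$ lies in a bounded connected component of $\mathbb R^n\setminus\Gamma$; and no nodal domain of $u$, i.e. no connected component $\Omega'$ of $\{x\in\Omega: u(x)\ne0\}$, satisfies $\overline{\Omega'}\subset\Omega$. -/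

import Mathlib

open Set Filter Topology

/-- The infinity Laplacian `Δ_∞ φ = ∑ i j, φ_{x_i} φ_{x_i x_j} φ_{x_j}` at `x`, that is, the second
derivative of `φ` at `x` evaluated twice on the gradient of `φ` at `x`. -/
noncomputable def infLaplacian {n : ℕ} (φ : EuclideanSpace ℝ (Fin n) → ℝ)
    (x : EuclideanSpace ℝ (Fin n)) : ℝ :=
  fderiv ℝ (fderiv ℝ φ) x (gradient φ x) (gradient φ x)

/-- The operator of the `∞`-eigenvalue equation, at a point `x` where the solution has the value
`r`, evaluated on a test function `φ`:
`min {|∇φ| - Λ r, -Δ_∞ φ}` if `r > 0`, `max {-|∇φ| - Λ r, -Δ_∞ φ}` if `r < 0`, and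
`-Δ_∞ φ` if `r = 0`. -/
noncomputable def inftyEigenOp {n : ℕ} (Λ r : ℝ) (φ : EuclideanSpace ℝ (Fin n) → ℝ)
    (x : EuclideanSpace ℝ (Fin n)) : ℝ :=
  if 0 < r then min (‖gradient φ x‖ - Λ * r) (-infLaplacian φ x)
  else if r < 0 then max (-‖gradient φ x‖ - Λ * r) (-infLaplacian φ x)
  else -infLaplacian φ x

/-- `ν` is a unit outer normal at `x` of the convex set `Ω`. Where the boundary is smooth there is
exactly one such `ν`; at a corner these are the unit vectors of the normal cone. -/
def IsUnitOuterNormal {n : ℕ} (Ω : Set (EuclideanSpace ℝ (Fin n)))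
    (x ν : EuclideanSpace ℝ (Fin n)) : Prop :=
  ‖ν‖ = 1 ∧ ∀ y ∈ Ω, inner ℝ ν (y - x) ≤ 0

/-- Viscosity subsolutions of the `∞`-eigenvalue equation in the convex open set `Ω` with the
Neumann boundary condition `∂u/∂ν = 0` in the viscosity sense. The test functions `φ` are `C²` near
`x` and touch `u` from above at `x` up to an additive constant. At a boundary point the condition
is `min {F, ∂φ/∂ν} ≤ 0`; at a corner `∂φ/∂ν` stands for its smallest value over the unit outer
normals, its lower semicontinuous envelope. -/
def IsNeumannSubsolution {n : ℕ} (Ω : Set (EuclideanSpace ℝ (Fin n))) (Λ : ℝ)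
    (u : EuclideanSpace ℝ (Fin n) → ℝ) : Prop :=
  ∀ x ∈ closure Ω, ∀ φ : EuclideanSpace ℝ (Fin n) → ℝ, ContDiffAt ℝ 2 φ x →
    IsLocalMaxOn (fun y => u y - φ y) (closure Ω) x →
    (x ∈ Ω → inftyEigenOp Λ (u x) φ x ≤ 0) ∧
    (x ∈ frontier Ω → ∃ ν, IsUnitOuterNormal Ω x ν ∧
      min (inftyEigenOp Λ (u x) φ x) (fderiv ℝ φ x ν) ≤ 0)

/-- Viscosity supersolutions of the `∞`-eigenvalue equation in the convex open set `Ω` with the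
Neumann boundary condition in the viscosity sense: the test functions touch `u` from below, and the
condition at a boundary point is `max {F, ∂φ/∂ν} ≥ 0`, where at a corner `∂φ/∂ν` stands for its
largest value over the unit outer normals. -/
def IsNeumannSupersolution {n : ℕ} (Ω : Set (EuclideanSpace ℝ (Fin n))) (Λ : ℝ)
    (u : EuclideanSpace ℝ (Fin n) → ℝ) : Prop :=
  ∀ x ∈ closure Ω, ∀ φ : EuclideanSpace ℝ (Fin n) → ℝ, ContDiffAt ℝ 2 φ x →
    IsLocalMinOn (fun y => u y - φ y) (closure Ω) x →
    (x ∈ Ω → 0 ≤ inftyEigenOp Λ (u x) φ x) ∧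
    (x ∈ frontier Ω → ∃ ν, IsUnitOuterNormal Ω x ν ∧
      0 ≤ max (inftyEigenOp Λ (u x) φ x) (fderiv ℝ φ x ν))

/-- `u` is a Neumann `∞`-eigenfunction of the convex open set `Ω` for the eigenvalue `Λ`: a
nontrivial viscosity solution, continuous up to the boundary. -/
structure IsNeumannInftyEigenfunction {n : ℕ} (Ω : Set (EuclideanSpace ℝ (Fin n))) (Λ : ℝ)
    (u : EuclideanSpace ℝ (Fin n) → ℝ) : Prop where
  continuousOn : ContinuousOn u (closure Ω)
  nontrivial : ∃ x ∈ Ω, u x ≠ 0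
  subsolution : IsNeumannSubsolution Ω Λ u
  supersolution : IsNeumannSupersolution Ω Λ u

/-- The number `Λ_∞(Ω) = 2 / diam Ω` of a bounded convex open set (for which the intrinsic diameter
is the Euclidean one). -/
noncomputable def neumannLambdaInfty {n : ℕ} (Ω : Set (EuclideanSpace ℝ (Fin n))) : ℝ :=
  2 / Metric.diam Ω

/-- The nodal set of `u` in `Ω`. -/
def nodalSet {n : ℕ} (Ω : Set (EuclideanSpace ℝ (Fin n)))
    (u : EuclideanSpace ℝ (Fin n) → ℝ) : Set (EuclideanSpace ℝ (Fin n)) :=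
  {x ∈ Ω | u x = 0}

/-- `D` is a nodal domain of `u` in `Ω`: a connected component of `{x ∈ Ω | u x ≠ 0}`. -/
def IsNodalDomain {n : ℕ} (Ω : Set (EuclideanSpace ℝ (Fin n)))
    (u : EuclideanSpace ℝ (Fin n) → ℝ) (D : Set (EuclideanSpace ℝ (Fin n))) : Prop :=
  ∃ x ∈ Ω, u x ≠ 0 ∧ D = connectedComponentIn {y ∈ Ω | u y ≠ 0} x

/-- `Γ` is a closed nodal line (in higher dimensions: a closed nodal hypersurface) of `u` inside
`Ω`: a compact subset of the nodal set that encloses some point where `u` does not vanish, in the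
sense that this point lies in a bounded connected component of the complement of `Γ`. No regularity
of `Γ` is required; a Jordan curve in a planar nodal set, with `u` not identically zero in the
interior of the curve, is an example. -/
def IsClosedNodalLine {n : ℕ} (Ω : Set (EuclideanSpace ℝ (Fin n)))
    (u : EuclideanSpace ℝ (Fin n) → ℝ) (Γ : Set (EuclideanSpace ℝ (Fin n))) : Prop :=
  IsCompact Γ ∧ Γ ⊆ nodalSet Ω u ∧
    ∃ x ∈ Ω, u x ≠ 0 ∧ Bornology.IsBounded (connectedComponentIn Γᶜ x)

/-! Suppose a nodal domain `D` had its closure in `Ω`; up to sign `u > 0` in `D`, with maximum `M`,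
and `u = 0` on `∂D`. Formally, where `|∇u| > Λ u` the subsolution is infinity-subharmonic, so it
compares with cones of slope `Λ M` with vertex outside `D`. At a maximum point `x₀` this gives `M ≤
Λ M |x₀ - x|` for every `x ∉ D`. Hence `D` contains the ball about `x₀` of radius `1 / Λ = diam Ω /
2`, and the open set `Ω` contains its closure, so `diam Ω` would exceed itself. A closed nodal line
reduces to this case, since a nodal domain it encloses has closure in `Ω` by convexity. -/

section RadialTestFunction

variable {n : ℕ}

/-- The function `b |y - x| - ε |y - x|²`, a concave perturbation of a cone with vertex `x`. -/
noncomputable def perturbedCone (x : EuclideanSpace ℝ (Fin n)) (b ε : ℝ)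
    (y : EuclideanSpace ℝ (Fin n)) : ℝ :=
  b * ‖y - x‖ - ε * ‖y - x‖ ^ 2

theorem hasFDerivAt_norm_sub {x y : EuclideanSpace ℝ (Fin n)} (hy : y ≠ x) :
    HasFDerivAt (fun z => ‖z - x‖) (‖y - x‖⁻¹ • innerSL ℝ (y - x)) y := by
  have h0 : ‖y - x‖ ≠ 0 := norm_ne_zero_iff.2 (sub_ne_zero.2 hy)
  have h1 : HasFDerivAt (fun z => ‖z - x‖ ^ 2) (2 • innerSL ℝ (y - x)) y := by
    simpa using ((hasFDerivAt_id y).sub_const x).norm_sq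
  have h2 := h1.sqrt (pow_ne_zero 2 h0)
  simp only [Real.sqrt_sq (norm_nonneg _)] at h2
  refine h2.congr_fderiv ?_
  ext v
  simp
  field_simp

theorem hasFDerivAt_perturbedCone {x y : EuclideanSpace ℝ (Fin n)} (b ε : ℝ) (hy : y ≠ x) :
    HasFDerivAt (perturbedCone x b ε) ((b * ‖y - x‖⁻¹ - 2 * ε) • innerSL ℝ (y - x)) y := by
  have h1 := hasFDerivAt_norm_sub hy
  have h2 : HasFDerivAt (fun z => ‖z - x‖ ^ 2) (2 • innerSL ℝ (y - x)) y := by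
    simpa using ((hasFDerivAt_id y).sub_const x).norm_sq
  refine ((h1.const_mul b).sub (h2.const_mul ε)).congr_fderiv ?_
  ext v
  simp
  ring

theorem gradient_perturbedCone {x y : EuclideanSpace ℝ (Fin n)} (b ε : ℝ) (hy : y ≠ x) :
    gradient (perturbedCone x b ε) y = (b * ‖y - x‖⁻¹ - 2 * ε) • (y - x) := by
  refine HasGradientAt.gradient ?_
  rw [hasGradientAt_iff_hasFDerivAt]
  refine (hasFDerivAt_perturbedCone b ε hy).congr_fderiv ?_
  ext v
  simp

theorem norm_gradient_perturbedCone {x y : EuclideanSpace ℝ (Fin n)} (b ε : ℝ) (hy : y ≠ x)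
    (h : 0 ≤ b - 2 * ε * ‖y - x‖) :
    ‖gradient (perturbedCone x b ε) y‖ = b - 2 * ε * ‖y - x‖ := by
  have h0 : 0 < ‖y - x‖ := norm_pos_iff.2 (sub_ne_zero.2 hy)
  have h1 : b - 2 * ε * ‖y - x‖ = (b * ‖y - x‖⁻¹ - 2 * ε) * ‖y - x‖ := by field_simp
  rw [gradient_perturbedCone b ε hy, norm_smul, Real.norm_eq_abs, abs_of_nonneg, h1]
  rw [h1] at h
  exact nonneg_of_mul_nonneg_left h h0

/-- A radial function `g(|y - x|)` has infinity Laplacian `g'' (g')²`. The cone alone gives `0`; the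
quadratic term makes `g'' = -2ε`, so comparison becomes strict. -/
theorem infLaplacian_perturbedCone {x y : EuclideanSpace ℝ (Fin n)} (b ε : ℝ) (hy : y ≠ x) :
    infLaplacian (perturbedCone x b ε) y = -(2 * ε) * (b - 2 * ε * ‖y - x‖) ^ 2 := by
  have h0 : ‖y - x‖ ≠ 0 := norm_ne_zero_iff.2 (sub_ne_zero.2 hy)
  have h1 : fderiv ℝ (perturbedCone x b ε) =ᶠ[𝓝 y]
      fun z => (b * ‖z - x‖⁻¹ - 2 * ε) • innerSL ℝ (z - x) := by
    filter_upwards [isOpen_ne.mem_nhds hy] with z hz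
    exact (hasFDerivAt_perturbedCone b ε hz).fderiv
  have h2 : HasFDerivAt (fun z => b * ‖z - x‖⁻¹ - 2 * ε)
      (b • (-(‖y - x‖ ^ 2)⁻¹ • (‖y - x‖⁻¹ • innerSL ℝ (y - x)))) y :=
    (((hasDerivAt_inv h0).comp_hasFDerivAt y (hasFDerivAt_norm_sub hy)).const_mul b).sub_const _
  have h3 : HasFDerivAt (fun z : EuclideanSpace ℝ (Fin n) => innerSL ℝ (z - x)) (innerSL ℝ) y :=
    (innerSL ℝ).hasFDerivAt.comp y ((hasFDerivAt_id y).sub_const x)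
  rw [infLaplacian, h1.fderiv_eq, (h2.fun_smul h3).fderiv, gradient_perturbedCone b ε hy]
  generalize y - x = z at h0 ⊢
  have h4 : innerSL ℝ z z = ‖z‖ ^ 2 := by simp
  simp only [add_apply, smul_apply, ContinuousLinearMap.smulRight_apply,
    map_smul, smul_eq_mul, h4]
  field_simp
  ring

theorem contDiffAt_perturbedCone {x y : EuclideanSpace ℝ (Fin n)} (b ε : ℝ) (hy : y ≠ x) :
    ContDiffAt ℝ 2 (perturbedCone x b ε) y := by
  have h1 : ContDiffAt ℝ 2 (fun z : EuclideanSpace ℝ (Fin n) => ‖z - x‖) y :=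
    (contDiffAt_id.sub contDiffAt_const).norm ℝ (sub_ne_zero.2 hy)
  exact (contDiffAt_const.mul h1).sub (contDiffAt_const.mul (h1.pow 2))

theorem continuous_perturbedCone (x : EuclideanSpace ℝ (Fin n)) (b ε : ℝ) :
    Continuous (perturbedCone x b ε) := by
  unfold perturbedCone
  fun_prop

theorem infLaplacian_neg (φ : EuclideanSpace ℝ (Fin n) → ℝ) (x : EuclideanSpace ℝ (Fin n)) :
    infLaplacian (-φ) x = -infLaplacian φ x := by
  have h1 : fderiv ℝ (-φ) = -fderiv ℝ φ := by
    ext1 y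
    exact fderiv_neg
  have h2 : gradient (-φ) x = -gradient φ x := by
    simp [gradient, h1]
  simp [infLaplacian, h1, h2, fderiv_neg]

theorem norm_gradient_neg (φ : EuclideanSpace ℝ (Fin n) → ℝ) (x : EuclideanSpace ℝ (Fin n)) :
    ‖gradient (-φ) x‖ = ‖gradient φ x‖ := by
  have h1 : fderiv ℝ (-φ) x = -fderiv ℝ φ x := fderiv_neg
  simp [gradient, h1]

end RadialTestFunction

/-- A positive subsolution of the `∞`-eigenvalue equation that vanishes on the boundary of a bounded
open set `D` attains its maximum at a point whose distance to the complement of `D` is at least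
`1 / Λ`. -/
theorem exists_one_le_mul_dist_of_subsolution {n : ℕ} {D : Set (EuclideanSpace ℝ (Fin n))}
    {Λ : ℝ} {u : EuclideanSpace ℝ (Fin n) → ℝ} (hD : IsOpen D) (hne : D.Nonempty)
    (hb : Bornology.IsBounded D) (hΛ : 0 ≤ Λ) (hu : ContinuousOn u (closure D))
    (hpos : ∀ y ∈ D, 0 < u y) (hzero : ∀ y ∈ closure D, y ∉ D → u y = 0)
    (hsub : ∀ y ∈ D, ∀ φ : EuclideanSpace ℝ (Fin n) → ℝ, ContDiffAt ℝ 2 φ y →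
      IsLocalMax (fun z => u z - φ z) y →
      min (‖gradient φ y‖ - Λ * u y) (-infLaplacian φ y) ≤ 0) :
    ∃ x₀ ∈ D, ∀ x ∉ D, 1 ≤ Λ * dist x₀ x := by
  have hK : IsCompact (closure D) := hb.isCompact_closure
  obtain ⟨y₁, hy₁⟩ := hne
  obtain ⟨x₀, hx₀, hmax⟩ := hK.exists_isMaxOn ⟨y₁, subset_closure hy₁⟩ hu
  have hM : 0 < u x₀ := (hpos y₁ hy₁).trans_le (hmax (subset_closure hy₁))
  have hx₀D : x₀ ∈ D := by
    by_contra h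
    exact hM.ne' (hzero x₀ hx₀ h)
  refine ⟨x₀, hx₀D, fun x hx => ?_⟩
  by_contra! hlt
  obtain ⟨R, hR⟩ := hb.subset_closedBall x
  have hRle : ∀ y ∈ D, ‖y - x‖ ≤ R := fun y hy => by
    simpa [dist_eq_norm] using hR hy
  have hR0 : 0 ≤ R := (norm_nonneg _).trans (hRle x₀ hx₀D)
  set r := ‖x₀ - x‖ with hr
  have hr0 : 0 ≤ r := norm_nonneg _
  have hgap : 0 < u x₀ - Λ * u x₀ * r := by
    rw [dist_eq_norm] at hlt
    nlinarith
  -- Small enough that the cone, steepened by `ε (2R + 1)`, still lies strictly below `u` at `x₀`.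
  obtain ⟨ε, hε, hεgap⟩ : ∃ ε > 0, ε * ((2 * R + 1) * r + 1) ≤ u x₀ - Λ * u x₀ * r :=
    ⟨(u x₀ - Λ * u x₀ * r) / ((2 * R + 1) * r + 1), by positivity,
      (div_mul_cancel₀ _ (by positivity)).le⟩
  -- On `D`, where `|y - x| ≤ R`, the radial slope `b - 2ε|y - x|` is then at least `Λ M + ε`.
  set b := Λ * u x₀ + ε * (2 * R + 1) with hbdef
  have hslope : ∀ y ∈ D, Λ * u x₀ < b - 2 * ε * ‖y - x‖ := fun y hy => by
    nlinarith [hRle y hy]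
  have hcont : ContinuousOn (fun y => u y - perturbedCone x b ε y) (closure D) :=
    hu.sub (continuous_perturbedCone x b ε).continuousOn
  obtain ⟨y, hy, hymax⟩ := hK.exists_isMaxOn ⟨y₁, subset_closure hy₁⟩ hcont
  have hx₀pos : 0 < u x₀ - perturbedCone x b ε x₀ := by
    have : 0 ≤ ε * r ^ 2 := by positivity
    simp only [perturbedCone, ← hr, hbdef]
    nlinarith
  -- On `∂D` the function `u` vanishes and the cone is nonnegative, while the difference is positive
  -- at `x₀`.
  have hyD : y ∈ D := by
    by_contra h
    have h1 : 0 < u y - perturbedCone x b ε y := hx₀pos.trans_le (hymax hx₀)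
    rw [hzero y hy h, perturbedCone] at h1
    have h2 : ‖y - x‖ ≤ R := by
      have := closure_minimal hR Metric.isClosed_closedBall hy
      simpa [dist_eq_norm] using this
    have h3 : 0 ≤ ‖y - x‖ := norm_nonneg _
    have h4 : 0 ≤ b - ε * ‖y - x‖ := by
      have : 0 ≤ Λ * u x₀ := by positivity
      nlinarith
    nlinarith
  have hyx : y ≠ x := fun h => hx (h ▸ hyD)
  have hs := hslope y hyD
  have hΛM : 0 ≤ Λ * u x₀ := by positivity
  have key := hsub y hyD _ (contDiffAt_perturbedCone b ε hyx)
    ((hymax.on_subset subset_closure).isLocalMax (hD.mem_nhds hyD))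
  rw [norm_gradient_perturbedCone b ε hyx (by linarith), infLaplacian_perturbedCone b ε hyx]
    at key
  -- Both entries of the minimum are in fact positive at `y`.
  rcases min_le_iff.1 key with h | h
  · have : Λ * u y ≤ Λ * u x₀ := mul_le_mul_of_nonneg_left (hmax hy) hΛ
    linarith
  · have : 0 < 2 * ε * (b - 2 * ε * ‖y - x‖) ^ 2 :=
      mul_pos (by linarith) (pow_pos (by linarith) 2)
    linarith

/-- The inequality is strict because openness lets a diameter of the ball be prolonged at one end.
-/
theorem two_mul_lt_diam_of_closedBall_subset {n : ℕ} (hn : 1 ≤ n)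
    {Ω : Set (EuclideanSpace ℝ (Fin n))} (hΩ : IsOpen Ω) (hb : Bornology.IsBounded Ω)
    {x₀ : EuclideanSpace ℝ (Fin n)} {r : ℝ} (hr : 0 ≤ r) (h : Metric.closedBall x₀ r ⊆ Ω) :
    2 * r < Metric.diam Ω := by
  obtain ⟨e, he⟩ : ∃ e : EuclideanSpace ℝ (Fin n), ‖e‖ = 1 :=
    ⟨EuclideanSpace.single ⟨0, hn⟩ 1, by simp⟩
  have h1 : x₀ + r • e ∈ Ω := h (by simp [norm_smul, he, abs_of_nonneg hr])
  have h2 : x₀ - r • e ∈ Ω := h (by simp [norm_smul, he, abs_of_nonneg hr])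
  obtain ⟨δ, hδ, hball⟩ := Metric.isOpen_iff.1 hΩ _ h1
  have h3 : x₀ + r • e + (δ / 2) • e ∈ Ω := hball (by
    simp [norm_smul, he, abs_of_pos hδ, hδ])
  have h4 := Metric.dist_le_diam_of_mem hb h3 h2
  have h5 : x₀ + r • e + (δ / 2) • e - (x₀ - r • e) = (2 * r + δ / 2) • e := by module
  rw [dist_eq_norm, h5, norm_smul, he, Real.norm_eq_abs, abs_of_pos (by positivity)] at h4
  linarith

/-- A bounded connected component of the complement of a compact subset of a convex open set
`Ω` has its closure in `Ω`. -/
theorem closure_connectedComponentIn_compl_subset {n : ℕ}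
    {Ω Γ : Set (EuclideanSpace ℝ (Fin n))} (hΩ : IsOpen Ω) (hc : Convex ℝ Ω)
    (hΓ : IsCompact Γ) (hΓΩ : Γ ⊆ Ω) {x : EuclideanSpace ℝ (Fin n)} (hx : x ∈ Ω)
    (hb : Bornology.IsBounded (connectedComponentIn Γᶜ x)) :
    closure (connectedComponentIn Γᶜ x) ⊆ Ω := by
  intro p hp
  by_contra hpΩ
  have hpΓ : p ∈ Γᶜ := fun h => hpΩ (hΓΩ h)
  -- Components of the open set `Γᶜ` are open, hence relatively closed in it.
  have hpC : p ∈ connectedComponentIn Γᶜ x := by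
    have hnhds : connectedComponentIn Γᶜ p ∈ 𝓝 p :=
      hΓ.isClosed.isOpen_compl.connectedComponentIn.mem_nhds (mem_connectedComponentIn hpΓ)
    obtain ⟨q, hq1, hq2⟩ := mem_closure_iff_nhds.1 hp _ hnhds
    rw [connectedComponentIn_eq hq2, ← connectedComponentIn_eq hq1]
    exact mem_connectedComponentIn hpΓ
  obtain ⟨f, hf⟩ := geometric_hahn_banach_open_point hc hΩ hpΩ
  have hv : 0 < f (p - x) := by
    rw [map_sub]
    linarith [hf x hx]
  -- The ray from `p` away from `x` stays on the far side of the separating hyperplane, so it misses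
  -- `Γ` and makes the component unbounded.
  set ray : ℝ → EuclideanSpace ℝ (Fin n) := fun t => p + t • (p - x) with hray
  have hsub : ray '' Ici 0 ⊆ Γᶜ := by
    rintro _ ⟨t, ht, rfl⟩ hmem
    have h1 := hf _ (hΓΩ hmem)
    rw [hray] at h1
    simp only [map_add, map_smul, smul_eq_mul] at h1
    have : 0 ≤ t * f (p - x) := mul_nonneg ht hv.le
    linarith
  have hconn : IsPreconnected (ray '' Ici 0) :=
    isPreconnected_Ici.image _ (by rw [hray]; fun_prop)
  have hrayC : ray '' Ici 0 ⊆ connectedComponentIn Γᶜ x := by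
    rw [connectedComponentIn_eq hpC]
    exact hconn.subset_connectedComponentIn ⟨0, self_mem_Ici, by simp [hray]⟩ hsub
  obtain ⟨R, hR⟩ := (hb.subset hrayC).subset_closedBall p
  have hpx : 0 < ‖p - x‖ := by
    rw [norm_pos_iff]
    rintro h
    simp [h] at hv
  have ht : 0 ≤ (|R| + 1) / ‖p - x‖ := by positivity
  have := hR ⟨_, ht, rfl⟩
  simp only [hray, Metric.mem_closedBall, dist_self_add_left, norm_smul, Real.norm_eq_abs,
    abs_of_nonneg ht, div_mul_cancel₀ _ hpx.ne'] at this
  linarith [le_abs_self R]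

theorem IsNodalDomain.not_closure_subset {n : ℕ} (hn : 1 ≤ n)
    {Ω : Set (EuclideanSpace ℝ (Fin n))} (hΩ : IsOpen Ω) (hb : Bornology.IsBounded Ω)
    {u : EuclideanSpace ℝ (Fin n) → ℝ}
    (hu : IsNeumannInftyEigenfunction Ω (neumannLambdaInfty Ω) u)
    {D : Set (EuclideanSpace ℝ (Fin n))} (hD : IsNodalDomain Ω u D) : ¬ closure D ⊆ Ω := by
  intro hcl
  obtain ⟨x, hxΩ, hux, rfl⟩ := hD
  set S := {y ∈ Ω | u y ≠ 0} with hS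
  set D := connectedComponentIn S x with hDdef
  have hcont : ContinuousOn u Ω := hu.continuousOn.mono subset_closure
  have hSo : IsOpen S := hcont.isOpen_inter_preimage hΩ isOpen_ne
  have hDo : IsOpen D := hSo.connectedComponentIn
  have hxD : x ∈ D := mem_connectedComponentIn ⟨hxΩ, hux⟩
  have hDS : D ⊆ S := connectedComponentIn_subset _ _
  have hDpre : IsPreconnected D := isPreconnected_connectedComponentIn
  have hDb : Bornology.IsBounded D := hb.subset fun y hy => (hDS hy).1
  have hcontD : ContinuousOn u (closure D) := hcont.mono hcl
  have hΛ : 0 ≤ neumannLambdaInfty Ω := div_nonneg zero_le_two Metric.diam_nonneg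
  have hzero : ∀ y ∈ closure D, y ∉ D → u y = 0 := by
    intro y hy hyD
    by_contra huy
    have hyS : y ∈ S := ⟨hcl hy, huy⟩
    have hpre : IsPreconnected (insert y D) :=
      hDpre.subset_closure (subset_insert y D) (insert_subset hy subset_closure)
    exact hyD (hpre.subset_connectedComponentIn (mem_insert_of_mem _ hxD)
      (insert_subset hyS hDS) (mem_insert _ _))
  have hfar : ∃ x₀ ∈ D, ∀ y ∉ D, 1 ≤ neumannLambdaInfty Ω * dist x₀ y := by
    have hivt : ∀ y ∈ D, ∀ z ∈ D, u y < 0 → ¬ 0 < u z := fun y hy z hz h1 h2 => by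
      obtain ⟨w, hw, hw0⟩ := hDpre.intermediate_value hy hz
        (hcontD.mono subset_closure) ⟨h1.le, h2.le⟩
      exact (hDS hw).2 hw0
    rcases hux.lt_or_gt with hneg | hpos
    · have hneg' : ∀ y ∈ D, u y < 0 := fun y hy =>
        lt_of_le_of_ne (not_lt.1 (hivt x hxD y hy hneg)) (hDS hy).2
      -- Where `u < 0`, the supersolution property of `u` is the subsolution property of `-u`.
      refine exists_one_le_mul_dist_of_subsolution (u := -u) hDo ⟨x, hxD⟩ hDb hΛ hcontD.neg
        (fun y hy => neg_pos.2 (hneg' y hy)) (fun y hy hyD => by simp [hzero y hy hyD]) ?_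
      intro y hy φ hφ hmax
      have hmin : IsLocalMin (fun z => u z - (-φ) z) y := by
        filter_upwards [hmax] with z hz
        simp only [Pi.neg_apply] at hz ⊢
        linarith
      have h := (hu.supersolution y (subset_closure (hDS hy).1) (-φ) hφ.neg (hmin.on _)).1
        (hDS hy).1
      rw [inftyEigenOp, if_neg (hneg' y hy).not_gt, if_pos (hneg' y hy), norm_gradient_neg,
        infLaplacian_neg] at h
      rw [Pi.neg_apply, min_le_iff]
      rcases le_max_iff.1 h with h | h
      · left; linarith
      · right; linarith
    · have hpos' : ∀ y ∈ D, 0 < u y := fun y hy =>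
        lt_of_le_of_ne (not_lt.1 fun h => hivt y hy x hxD h hpos) (hDS hy).2.symm
      refine exists_one_le_mul_dist_of_subsolution hDo ⟨x, hxD⟩ hDb hΛ hcontD hpos' hzero ?_
      intro y hy φ hφ hmax
      have h := (hu.subsolution y (subset_closure (hDS hy).1) φ hφ (hmax.on _)).1 (hDS hy).1
      rwa [inftyEigenOp, if_pos (hpos' y hy)] at h
  obtain ⟨x₀, hx₀, hdist⟩ := hfar
  have hball : Metric.ball x₀ (Metric.diam Ω / 2) ⊆ D := by
    intro y hy
    by_contra hyD
    have h1 := hdist y hyD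
    rw [Metric.mem_ball'] at hy
    have hd : 0 < Metric.diam Ω := by linarith [dist_nonneg (x := x₀) (y := y)]
    rw [neumannLambdaInfty, div_mul_eq_mul_div, le_div_iff₀ hd] at h1
    linarith
  have hcball : Metric.closedBall x₀ (Metric.diam Ω / 2) ⊆ Ω := by
    rcases eq_or_ne (Metric.diam Ω / 2) 0 with h0 | h0
    · rw [h0, Metric.closedBall_zero, singleton_subset_iff]
      exact (hDS hx₀).1
    · rw [← closure_ball x₀ h0]
      exact (closure_mono hball).trans hcl
  have := two_mul_lt_diam_of_closedBall_subset hn hΩ hb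
    (div_nonneg Metric.diam_nonneg zero_le_two) hcball
  linarith

theorem mainTheorem5 (n : ℕ) (hn : 1 ≤ n) (Ω : Set (EuclideanSpace ℝ (Fin n)))
    (hΩ_open : IsOpen Ω) (hΩ_nonempty : Ω.Nonempty) (hΩ_bounded : Bornology.IsBounded Ω)
    (hΩ_convex : Convex ℝ Ω) (u : EuclideanSpace ℝ (Fin n) → ℝ)
    (hu : IsNeumannInftyEigenfunction Ω (neumannLambdaInfty Ω) u) :
    (¬ ∃ Γ, IsClosedNodalLine Ω u Γ) ∧
      ∀ D, IsNodalDomain Ω u D → ¬ closure D ⊆ Ω := by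
  refine ⟨?_, fun D hD => hD.not_closure_subset hn hΩ_open hΩ_bounded hu⟩
  rintro ⟨Γ, hΓ, hΓu, x, hx, hux, hbdd⟩
  have hD : IsNodalDomain Ω u (connectedComponentIn {y ∈ Ω | u y ≠ 0} x) := ⟨x, hx, hux, rfl⟩
  refine hD.not_closure_subset hn hΩ_open hΩ_bounded hu (Subset.trans (closure_mono ?_)
    (closure_connectedComponentIn_compl_subset hΩ_open hΩ_convex hΓ (fun y hy => (hΓu hy).1) hx
      hbdd))
  -- Nodal domains avoid `Γ`, as `u` vanishes there.
  exact connectedComponentIn_mono x fun y hy hyΓ => hy.2 (hΓu hyΓ).2
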